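/- Let $K\ge 2$. A multinomial opinion on $K$ classes consists of belief masses $b_k\ge 0$, an uncertainty mass $u\ge 0$ with $\sum_k b_k+u=1$, and a base rate distribution. Its vacuity is $u$, and its dissonance is $$\mathrm{diss}(b)=\sum_{k=1}^K \frac{b_k\sum_{j\ne k} b_j\,\mathrm{Bal}(b_j,b_k)}{\sum_{j\ne k} b_j},\qquad \mathrm{Bal}(x,y)=1-\frac{|x-y|}{x+y}\ \text{ if } xy\ne 0,\quad \mathrm{Bal}(x,y)=0\ \text{ otherwise},$$ where a summand with zero denominator is $0$. For $\alpha\in(0,\infty)^K$ let $S=\sum_i\alpha_i$, $u_v=K/S$, $b_k=(\alpha_k-1)/S$, $u_{diss}=\mathrm{diss}(b)$. Let $\mathbf p\sim \mathrm{Dir}(\alpha)$ and $y\sim\mathrm{Cat}(\mathbf p)$. With $\mathcal H$ the Shannon entropy with logarithms to base $K$, let $$u_{en}=\mathcal H\big[\mathbb E\,\mathbf p\big],\qquad u_{alea}=\mathbb E\,\mathcal H[\mathbf p],\qquad u_{epis}=u_{en}-u_{alea},$$ so that $u_{epis}$ is the mutual information between $y$ and $\mathbf p$; let $\mathcal I=u_{epis}\ln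 K$ be the same quantity in natural logarithms. Let $\mathcal K=\mathbb E\big[\mathrm{KL}(\mathrm{Cat}(\mathbf p_1)\,\|\,\mathrm{Cat}(\mathbf p_2))\big]$ (natural logarithms) with $\mathbf p_1,\mathbf p_2\sim\mathrm{Dir}(\alpha)$ independent, and let $\psi=(\ln\Gamma)'$. 1. General relations. (a) Every opinion satisfies $u+\mathrm{diss}(b)\le 1$; in particular $u_v+u_{diss}\le 1$ whenever all $\alpha_k\ge 1$. (b) For every $\alpha\in(0,\infty)^K$: $u_v>u_{epis}$ and $u_v>\mathcal I$; moreover the divergence defining $\mathcal K$ is integrable and $\mathcal I\le\mathcal K=(K-1)/S$. Also $$u_{alea}=\frac1{\ln K}\sum_{k=1}^K\frac{\alpha_k}{S}\big(\psi(S+1)-\psi(\alpha_k+1)\big),\qquad u_{epis}=-\sum_{k=1}^K\frac{\alpha_k}{S}\log_K\frac{\alpha_k}{S}-u_{alea}.$$ 2. Special relations. (a) For $\alpha=(1,\dots,1)$: $1=u_v=u_{en}>u_{alea}>u_{epis}>u_{diss}=0$, and $u_{alea}=\frac1{\ln K}\sum_{k=2}^K\frac1k=1-u_{epis}$. (b)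 For $\alpha=(C,\dots,C)$ with real $C>0$ (so $S=KC$): $u_{en}=1$ for every $C$, and for fixed $K$, as $C\to\infty$ (equivalently $S\to\infty$), $u_{diss}\to1$, $u_{alea}\to1$, $u_v\to0$, $u_{epis}\to0$. For every $C>2$, $u_{en}>u_{alea}>u_{diss}>u_v>u_{epis}$. For every integer $C\ge1$, $u_{alea}=\frac1{\ln K}\sum_{k=C+1}^{CK}\frac1k=1-u_{epis}$. -/

import Mathlib

open MeasureTheory Filter Topology

namespace DirichletUncertainty

noncomputable section

/-- A multinomial opinion on a domain of `K` classes: belief masses `b`, uncertainty mass `u`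
and base rates `a`. -/
structure Opinion (K : ℕ) where
  b : Fin K → ℝ
  u : ℝ
  a : Fin K → ℝ
  b_nonneg : ∀ k, 0 ≤ b k
  u_nonneg : 0 ≤ u
  a_nonneg : ∀ k, 0 ≤ a k
  sum_b_add_u : (∑ k, b k) + u = 1
  sum_a : ∑ k, a k = 1

/-- The relative mass balance between two belief masses. -/
def bal (x y : ℝ) : ℝ :=
  if x * y ≠ 0 then 1 - |x - y| / (x + y) else 0

/-- The dissonance of the belief masses `b`; a summand with vanishing denominator is `0`. -/
def dissonance {K : ℕ} (b : Fin K → ℝ) : ℝ :=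
  ∑ k, b k * (∑ j ∈ Finset.univ.erase k, b j * bal (b j) (b k)) /
    ∑ j ∈ Finset.univ.erase k, b j

/-- The total strength `S` of a Dirichlet parameter. -/
def strength {K : ℕ} (α : Fin K → ℝ) : ℝ := ∑ k, α k

/-- The belief masses `e k / S`, with evidence `e k = α k - 1` (prior weight `W = K` and
uniform base rates `1 / K`). -/
def belief {K : ℕ} (α : Fin K → ℝ) (k : Fin K) : ℝ := (α k - 1) / strength α

/-- The vacuity `W / S` with prior weight `W = K`. -/
def vacuity {K : ℕ} (α : Fin K → ℝ) : ℝ := (K : ℝ) / strength α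

/-- The measure `dp` on the probability simplex of `K` classes: Lebesgue measure in the first
`K - 1` coordinates, the last coordinate being one minus their sum. -/
def simplexVolume : (K : ℕ) → Measure (Fin K → ℝ)
  | 0 => 0
  | n + 1 =>
    ((volume : Measure (Fin n → ℝ)).restrict {x | (∀ i, 0 < x i) ∧ ∑ i, x i < 1}).map
      fun x => Fin.snoc (α := fun _ => ℝ) x (1 - ∑ i, x i)

/-- The Dirichlet density with parameter `α`. -/
def dirichletPDF {K : ℕ} (α : Fin K → ℝ) (p : Fin K → ℝ) : ℝ :=
  Real.Gamma (strength α) / (∏ k, Real.Gamma (α k)) * ∏ k, p k ^ (α k - 1)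

/-- The Dirichlet distribution `Dir(α)`. -/
def dirichlet {K : ℕ} (α : Fin K → ℝ) : Measure (Fin K → ℝ) :=
  (simplexVolume K).withDensity fun p => ENNReal.ofReal (dirichletPDF α p)

/-- Shannon entropy, with logarithms to base `β`, of the categorical distribution `Cat(p)`. -/
def shannonEntropy {K : ℕ} (β : ℝ) (p : Fin K → ℝ) : ℝ := -∑ k, p k * Real.logb β (p k)

/-- The marginal law `P(y = k) = ∫ p k` of `y ∼ Cat(p)` with `p ∼ Dir(α)`. -/
def predictive {K : ℕ} (α : Fin K → ℝ) (k : Fin K) : ℝ := ∫ p, p k ∂(dirichlet α)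

/-- Total uncertainty: the entropy of the marginal law of `y`. -/
def entropy {K : ℕ} (β : ℝ) (α : Fin K → ℝ) : ℝ := shannonEntropy β (predictive α)

/-- Aleatoric uncertainty: the expected entropy of `Cat(p)`. -/
def aleatoric {K : ℕ} (β : ℝ) (α : Fin K → ℝ) : ℝ := ∫ p, shannonEntropy β p ∂(dirichlet α)

/-- Epistemic uncertainty: the mutual information between `y` and `p`. -/
def epistemic {K : ℕ} (β : ℝ) (α : Fin K → ℝ) : ℝ := entropy β α - aleatoric β α

/-- Kullback-Leibler divergence, with natural logarithms, of `Cat(p)` from `Cat(q)`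
(used where all `q k` are positive). -/
def klCat {K : ℕ} (p q : Fin K → ℝ) : ℝ := ∑ k, p k * Real.log (p k / q k)

/-- The expected Kullback-Leibler divergence between `Cat(p)` and `Cat(q)` for independent
`p, q ∼ Dir(α)`. -/
def expectedPairwiseKL {K : ℕ} (α : Fin K → ℝ) : ℝ :=
  ∫ z, klCat z.1 z.2 ∂((dirichlet α).prod (dirichlet α))

/-- The digamma function on the positive reals, `(log Γ)'`. -/
def digamma (x : ℝ) : ℝ := deriv (fun t => Real.log (Real.Gamma t)) x

end

end DirichletUncertainty

open DirichletUncertainty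

/-! Everything about the Dirichlet law is read off from one function, the moment generating function
of `log p_k`, that is `E[p_k ^ t] = Γ(S) Γ(α_k + t) / (Γ(α_k) Γ(S + t))`, a ratio of normalising
constants. Its value at 1 is the mean `α_k / S`; its derivatives at 0 and 1 give `E[log p_k]` and
`E[p_k log p_k]` in digamma values, hence the entropy formulas.

By independence the expected divergence is a sum of such terms, which `ψ(x + 1) = ψ(x) + 1/x`
collapses to `(K - 1)/S`. Jensen for `log` bounds the mutual information by it, and `ln K > 1 - 1/K`
carries the bound to base `K`. Strict Jensen for `x log x` makes the mutual information positive.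

For equal parameters `C`, vacuity is `1/C`, dissonance is `1 - 1/C` when `C > 1`, and aleatoric
uncertainty is `1 - u_epis`, so the orderings and limits follow from `0 < u_epis < 1/C`. Only
`u_alea > u_epis` at `C = 1` needs a harmonic sum estimate. -/

/-! ### Beta and Dirichlet integrals -/

theorem lintegral_rpow_mul_sub_rpow {a b r : ℝ} (ha : 0 < a) (hb : 0 < b) (hr : 0 < r) :
    ∫⁻ x in Set.Ioo 0 r, ENNReal.ofReal (x ^ (a - 1) * (r - x) ^ (b - 1)) =
      ENNReal.ofReal (Real.Gamma a * Real.Gamma b / Real.Gamma (a + b) * r ^ (a + b - 1)) := by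
  -- Rescaling to the unit interval reduces the integral to the normalisation of the beta density.
  have himg : Set.Ioo 0 r = (fun x => r * x) '' Set.Ioo 0 1 := by
    rw [Set.image_mul_left_Ioo hr]; simp
  have hB := ProbabilityTheory.beta_pos ha hb
  rw [himg, lintegral_image_eq_lintegral_abs_deriv_mul measurableSet_Ioo (f' := fun _ => r)
    (fun x _ => by simpa using ((hasDerivAt_id x).const_mul r).hasDerivWithinAt)
    (fun x _ y _ h => mul_left_cancel₀ hr.ne' h)]
  have key : ∀ x ∈ Set.Ioo (0 : ℝ) 1,
      ENNReal.ofReal |r| * ENNReal.ofReal ((r * x) ^ (a - 1) * (r - r * x) ^ (b - 1)) =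
        ENNReal.ofReal (ProbabilityTheory.beta a b * r ^ (a + b - 1)) *
          ENNReal.ofReal (1 / ProbabilityTheory.beta a b * x ^ (a - 1) * (1 - x) ^ (b - 1)) := by
    intro x hx
    have h1 : 0 < 1 - x := by linarith [hx.2]
    rw [← ENNReal.ofReal_mul (abs_nonneg r), ← ENNReal.ofReal_mul (by positivity), abs_of_pos hr,
      show r - r * x = r * (1 - x) by ring, Real.mul_rpow hr.le hx.1.le,
      Real.mul_rpow hr.le h1.le, show a + b - 1 = 1 + (a - 1) + (b - 1) by ring,
      Real.rpow_add hr, Real.rpow_add hr, Real.rpow_one]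
    congr 1
    field_simp
  rw [setLIntegral_congr_fun measurableSet_Ioo key, lintegral_const_mul _ (by fun_prop),
    ← ProbabilityTheory.lintegral_betaPDF, ProbabilityTheory.lintegral_betaPDF_eq_one ha hb,
    mul_one, ProbabilityTheory.beta]

theorem measurableSet_solidSimplex (n : ℕ) (r : ℝ) :
    MeasurableSet {x : Fin n → ℝ | (∀ i, 0 < x i) ∧ ∑ i, x i < r} := by
  measurability

/-- Fixing the first coordinate `x` leaves a simplex of size `r - x`, which is why `r` is general in
the induction. The remaining integral over `x` is a beta integral with parameters `a 0` and the sum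
of all others. -/
theorem lintegral_solidSimplex {n : ℕ} (a : Fin n → ℝ) (ha : ∀ i, 0 < a i) {b r : ℝ}
    (hb : 0 < b) (hr : 0 < r) :
    ∫⁻ x in {x : Fin n → ℝ | (∀ i, 0 < x i) ∧ ∑ i, x i < r},
        ENNReal.ofReal ((∏ i, x i ^ (a i - 1)) * (r - ∑ i, x i) ^ (b - 1)) =
      ENNReal.ofReal ((∏ i, Real.Gamma (a i)) * Real.Gamma b / Real.Gamma (∑ i, a i + b) *
        r ^ (∑ i, a i + b - 1)) := by
  induction n generalizing r with
  | zero =>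
    simp [hr, (Real.Gamma_pos_of_pos hb).ne', volume_pi]
  | succ n ih =>
    set t : Fin n → ℝ := fun i => a i.succ
    have hs : 0 < ∑ i, t i + b := add_pos_of_nonneg_of_pos
      (Finset.sum_nonneg fun i _ => (ha i.succ).le) hb
    rw [← lintegral_indicator (measurableSet_solidSimplex _ _),
      ← (volume_preserving_piFinSuccAbove (fun _ : Fin (n + 1) => ℝ) 0).symm.lintegral_comp_emb
        (MeasurableEquiv.measurableEmbedding _),
      Measure.volume_eq_prod, lintegral_prod _ (by
        refine Measurable.aemeasurable ?_
        exact Measurable.comp (g := Set.indicator _ _)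
          (Measurable.indicator (by fun_prop) (measurableSet_solidSimplex _ _))
          (MeasurableEquiv.measurable _))]
    have inner : ∀ x : ℝ, (∫⁻ y : Fin n → ℝ, {x : Fin (n + 1) → ℝ | (∀ i, 0 < x i) ∧
          ∑ i, x i < r}.indicator (fun x => ENNReal.ofReal ((∏ i, x i ^ (a i - 1)) *
            (r - ∑ i, x i) ^ (b - 1)))
          ((MeasurableEquiv.piFinSuccAbove (fun _ : Fin (n + 1) => ℝ) 0).symm (x, y))) =
        (Set.Ioo 0 r).indicator (fun x => ENNReal.ofReal ((∏ i, Real.Gamma (t i)) *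
          Real.Gamma b / Real.Gamma (∑ i, t i + b)) *
          ENNReal.ofReal (x ^ (a 0 - 1) * (r - x) ^ (∑ i, t i + b - 1))) x := by
      intro x
      by_cases hx : x ∈ Set.Ioo 0 r
      · have hrx : 0 < r - x := sub_pos.2 hx.2
        rw [Set.indicator_of_mem hx]
        have := ih t (fun i => ha i.succ) hrx
        have hG : 0 ≤ (∏ i, Real.Gamma (t i)) * Real.Gamma b / Real.Gamma (∑ i, t i + b) :=
          div_nonneg (mul_nonneg (Finset.prod_nonneg fun i _ => (Real.Gamma_pos_of_pos
            (ha i.succ)).le) (Real.Gamma_pos_of_pos hb).le) (Real.Gamma_pos_of_pos hs).le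
        rw [mul_comm (x ^ (a 0 - 1)), ENNReal.ofReal_mul (p := (r - x) ^ _) (by positivity),
          ← mul_assoc, ← ENNReal.ofReal_mul hG, ← this,
          ← lintegral_indicator (measurableSet_solidSimplex _ _),
          ← lintegral_mul_const _ (by
            exact Measurable.indicator (by fun_prop) (measurableSet_solidSimplex _ _))]
        congr 1
        ext y
        by_cases hy : y ∈ {y : Fin n → ℝ | (∀ i, 0 < y i) ∧ ∑ i, y i < r - x}
        · rw [Set.indicator_of_mem hy, Set.indicator_of_mem]
          · have h0 : 0 ≤ r - x - ∑ i, y i := by linarith [hy.2]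
            rw [← ENNReal.ofReal_mul (mul_nonneg (Finset.prod_nonneg fun i _ =>
              Real.rpow_nonneg (hy.1 i).le _) (Real.rpow_nonneg h0 _))]
            congr 1
            simp [MeasurableEquiv.piFinSuccAbove_symm_apply, Fin.insertNthEquiv,
              Fin.prod_univ_succ, Fin.sum_univ_succ, t, sub_sub]
            ring
          · simp only [MeasurableEquiv.piFinSuccAbove_symm_apply, Fin.insertNthEquiv]
            refine ⟨fun i => ?_, ?_⟩
            · refine Fin.cases ?_ (fun i => ?_) i
              · simpa using hx.1
              · simpa using hy.1 i
            · simp [Fin.sum_univ_succ]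
              linarith [hy.2]
        · rw [Set.indicator_of_notMem hy, Set.indicator_of_notMem, zero_mul]
          rintro ⟨h1, h2⟩
          refine hy ⟨fun i => by simpa [MeasurableEquiv.piFinSuccAbove_symm_apply,
            Fin.insertNthEquiv] using h1 i.succ, ?_⟩
          simp [MeasurableEquiv.piFinSuccAbove_symm_apply, Fin.insertNthEquiv,
            Fin.sum_univ_succ] at h2
          linarith
      · rw [Set.indicator_of_notMem hx]
        refine (lintegral_congr fun y => ?_).trans lintegral_zero
        rw [Set.indicator_of_notMem]
        rintro ⟨h1, h2⟩
        simp only [MeasurableEquiv.piFinSuccAbove_symm_apply, Fin.insertNthEquiv] at h1 h2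
        have h3 : ∀ i, 0 < y i := fun i => by simpa using h1 i.succ
        simp [Fin.sum_univ_succ] at h2
        exact hx ⟨by simpa using h1 0,
          by linarith [Finset.sum_nonneg fun i (_ : i ∈ Finset.univ) => (h3 i).le]⟩
    simp_rw [inner]
    rw [lintegral_indicator measurableSet_Ioo, lintegral_const_mul _ (by fun_prop),
      lintegral_rpow_mul_sub_rpow (ha 0) hs hr, ← ENNReal.ofReal_mul
        (div_nonneg (mul_nonneg (Finset.prod_nonneg fun i _ => (Real.Gamma_pos_of_pos
            (ha i.succ)).le) (Real.Gamma_pos_of_pos hb).le) (Real.Gamma_pos_of_pos hs).le)]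
    congr 1
    rw [Fin.sum_univ_succ, Fin.prod_univ_succ, ← add_assoc]
    have := (Real.Gamma_pos_of_pos hs).ne'
    simp only [t] at this ⊢
    field_simp

/-! ### The Dirichlet distribution as a probability measure -/

theorem measurable_snoc_one_sub_sum (n : ℕ) : Measurable fun x : Fin n → ℝ =>
    (Fin.snoc (α := fun _ => ℝ) x (1 - ∑ i, x i) : Fin (n + 1) → ℝ) := by
  refine measurable_pi_lambda _ fun i => ?_
  refine Fin.lastCases ?_ (fun i => ?_) i
  · simp only [Fin.snoc_last]; fun_prop
  · simp only [Fin.snoc_castSucc]; fun_prop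

theorem ae_simplexVolume (K : ℕ) :
    ∀ᵐ p ∂simplexVolume K, (∀ k, 0 < p k) ∧ ∑ k, p k = 1 := by
  cases K with
  | zero => simp [simplexVolume]
  | succ n =>
    rw [simplexVolume, ae_map_iff (measurable_snoc_one_sub_sum n).aemeasurable (by measurability)]
    refine ae_restrict_of_forall_mem (measurableSet_solidSimplex n 1) fun x hx => ?_
    refine ⟨fun k => ?_, by simp [Fin.sum_univ_castSucc]⟩
    refine Fin.lastCases ?_ (fun i => ?_) k
    · simpa using hx.2
    · simpa using hx.1 i

theorem ae_dirichlet {K : ℕ} (α : Fin K → ℝ) :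
    ∀ᵐ p ∂dirichlet α, (∀ k, 0 < p k) ∧ ∑ k, p k = 1 :=
  (withDensity_absolutelyContinuous _ _).ae_le (ae_simplexVolume K)

@[fun_prop]
theorem measurable_dirichletPDF {K : ℕ} (α : Fin K → ℝ) : Measurable (dirichletPDF α) := by
  unfold dirichletPDF; fun_prop

theorem strength_pos {K : ℕ} (hK : 0 < K) {α : Fin K → ℝ} (hα : ∀ k, 0 < α k) :
    0 < strength α :=
  Finset.sum_pos (fun k _ => hα k) ⟨⟨0, hK⟩, Finset.mem_univ _⟩

theorem lintegral_dirichletPDF {K : ℕ} (hK : 0 < K) {α : Fin K → ℝ} (hα : ∀ k, 0 < α k) :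
    ∫⁻ p, ENNReal.ofReal (dirichletPDF α p) ∂simplexVolume K = 1 := by
  have hS := strength_pos hK hα
  obtain ⟨n, rfl⟩ := Nat.exists_eq_succ_of_ne_zero hK.ne'
  have hG := Real.Gamma_pos_of_pos hS
  have hP : 0 < ∏ k, Real.Gamma (α k) := Finset.prod_pos fun k _ => Real.Gamma_pos_of_pos (hα k)
  rw [simplexVolume, lintegral_map (by fun_prop) (measurable_snoc_one_sub_sum n)]
  have key : ∀ x : Fin n → ℝ, ENNReal.ofReal (dirichletPDF α
      (Fin.snoc (α := fun _ => ℝ) x (1 - ∑ i, x i))) =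
      ENNReal.ofReal (Real.Gamma (strength α) / ∏ k, Real.Gamma (α k)) *
      ENNReal.ofReal ((∏ i, x i ^ (α i.castSucc - 1)) *
        (1 - ∑ i, x i) ^ (α (Fin.last n) - 1)) := by
    intro x
    rw [← ENNReal.ofReal_mul (by positivity)]
    simp [dirichletPDF, Fin.prod_univ_castSucc]
  simp_rw [key]
  rw [lintegral_const_mul _ (by fun_prop),
    lintegral_solidSimplex (fun i : Fin n => α i.castSucc) (fun i => hα _) (hα _) one_pos,
    ← ENNReal.ofReal_mul (by positivity), ← Fin.prod_univ_castSucc fun k => Real.Gamma (α k),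
    ← Fin.sum_univ_castSucc α, Real.one_rpow, ← ENNReal.ofReal_one]
  congr 1
  change _ * (_ / Real.Gamma (strength α) * 1) = _
  field_simp

theorem isProbabilityMeasure_dirichlet {K : ℕ} (hK : 0 < K) {α : Fin K → ℝ}
    (hα : ∀ k, 0 < α k) : IsProbabilityMeasure (dirichlet α) :=
  ⟨by rw [dirichlet, withDensity_apply _ MeasurableSet.univ, setLIntegral_univ,
    lintegral_dirichletPDF hK hα]⟩

/-! ### Moments and logarithmic moments -/

/-- The moment `E[p_k ^ t]` of the Dirichlet distribution. -/
theorem lintegral_exp_mul_log_dirichlet {K : ℕ} {α : Fin K → ℝ} (hα : ∀ k, 0 < α k)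
    (k : Fin K) {t : ℝ} (ht : -α k < t) :
    ∫⁻ p, ENNReal.ofReal (Real.exp (t * Real.log (p k))) ∂dirichlet α =
      ENNReal.ofReal (Real.Gamma (strength α) * Real.Gamma (α k + t) /
        (Real.Gamma (α k) * Real.Gamma (strength α + t))) := by
  -- Multiplying the density by `p_k ^ t` shifts the `k`-th parameter by `t`, giving up to a
  -- constant the density of `Dir(β)`, whose total mass is 1.
  have hK : 0 < K := k.pos
  have hkt : 0 < α k + t := by linarith
  set β := Function.update α k (α k + t)
  have hβ : ∀ i, 0 < β i := fun i => by
    by_cases h : i = k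
    · subst h; simpa [β] using hkt
    · simpa [β, h] using hα i
  have hS := strength_pos hK hα
  have hSt : strength β = strength α + t := by
    have : ∀ i, β i = α i + if i = k then t else 0 := fun i => by
      by_cases h : i = k
      · subst h; simp [β]
      · simp [β, h]
    simp [strength, this, Finset.sum_add_distrib]
  have hS' := strength_pos hK hβ
  have hGk := Real.Gamma_pos_of_pos (hα k)
  have hGkt := Real.Gamma_pos_of_pos hkt
  have hGS := Real.Gamma_pos_of_pos hS
  have hGS' := Real.Gamma_pos_of_pos hS'
  have hPG : 0 < ∏ k, Real.Gamma (α k) := Finset.prod_pos fun k _ => Real.Gamma_pos_of_pos (hα k)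
  have hprod : ∏ i, Real.Gamma (β i) =
      (∏ i, Real.Gamma (α i)) * (Real.Gamma (α k + t) / Real.Gamma (α k)) := by
    have : ∀ i, Real.Gamma (β i) =
        Real.Gamma (α i) * if i = k then Real.Gamma (α k + t) / Real.Gamma (α k) else 1 := by
      intro i
      by_cases h : i = k
      · subst h
        simp only [β, Function.update_self, if_true]
        field_simp
      · simp [β, h]
    simp_rw [this]
    rw [Finset.prod_mul_distrib, Finset.prod_ite_eq', if_pos (Finset.mem_univ k)]
  rw [dirichlet, lintegral_withDensity_eq_lintegral_mul _ (by fun_prop) (by fun_prop),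
    ← mul_one (ENNReal.ofReal (_ / _)), ← lintegral_dirichletPDF hK hβ,
    ← lintegral_const_mul _ (by fun_prop)]
  refine lintegral_congr_ae ?_
  filter_upwards [ae_simplexVolume K] with p hp
  have hpow : ∏ i, p i ^ (β i - 1) = (∏ i, p i ^ (α i - 1)) * p k ^ t := by
    have : ∀ i, p i ^ (β i - 1) = p i ^ (α i - 1) * if i = k then p k ^ t else 1 := by
      intro i
      by_cases h : i = k
      · subst h
        simp only [β, Function.update_self, if_true]
        rw [← Real.rpow_add (hp.1 i)]
        ring_nf
      · simp [β, h]
    simp_rw [this]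
    rw [Finset.prod_mul_distrib, Finset.prod_ite_eq', if_pos (Finset.mem_univ k)]
  have hexp : Real.exp (t * Real.log (p k)) = p k ^ t := by
    rw [Real.rpow_def_of_pos (hp.1 k), mul_comm]
  have hpdf : 0 ≤ dirichletPDF α p := mul_nonneg (div_nonneg hGS.le hPG.le)
    (Finset.prod_nonneg fun i _ => Real.rpow_nonneg (hp.1 i).le _)
  rw [Pi.mul_apply, hexp, ← ENNReal.ofReal_mul hpdf, ← ENNReal.ofReal_mul (by
    rw [← hSt]; positivity)]
  congr 1
  rw [dirichletPDF, dirichletPDF, hpow, hprod, hSt]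
  rw [hSt] at hGS'
  field_simp

theorem integrable_exp_mul_log_dirichlet {K : ℕ} {α : Fin K → ℝ} (hα : ∀ k, 0 < α k)
    (k : Fin K) {t : ℝ} (ht : -α k < t) :
    Integrable (fun p => Real.exp (t * Real.log (p k))) (dirichlet α) := by
  refine ⟨Measurable.aestronglyMeasurable (by fun_prop), ?_⟩
  rw [hasFiniteIntegral_iff_ofReal (ae_of_all _ fun p => (Real.exp_pos _).le),
    lintegral_exp_mul_log_dirichlet hα k ht]
  exact ENNReal.ofReal_lt_top

theorem mgf_log_dirichlet {K : ℕ} {α : Fin K → ℝ} (hα : ∀ k, 0 < α k)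
    (k : Fin K) {t : ℝ} (ht : -α k < t) :
    ProbabilityTheory.mgf (fun p => Real.log (p k)) (dirichlet α) t =
      Real.Gamma (strength α) * Real.Gamma (α k + t) /
        (Real.Gamma (α k) * Real.Gamma (strength α + t)) := by
  have hk : α k ≤ strength α :=
    Finset.single_le_sum (fun i _ => (hα i).le) (Finset.mem_univ k)
  have h1 := Real.Gamma_pos_of_pos (show 0 < α k + t by linarith)
  have h2 := Real.Gamma_pos_of_pos (show 0 < strength α + t by linarith)
  have h3 := Real.Gamma_pos_of_pos (hα k)
  have h4 := Real.Gamma_pos_of_pos ((hα k).trans_le hk)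
  rw [ProbabilityTheory.mgf, integral_eq_lintegral_of_nonneg_ae
    (ae_of_all _ fun p => (Real.exp_pos _).le) (Measurable.aestronglyMeasurable (by fun_prop)),
    lintegral_exp_mul_log_dirichlet hα k ht, ENNReal.toReal_ofReal (by positivity)]

/-- Lying in the interior permits differentiation under the integral sign; both 0 and 1 qualify. -/
theorem mem_interior_integrableExpSet_log_dirichlet {K : ℕ} {α : Fin K → ℝ}
    (hα : ∀ k, 0 < α k) (k : Fin K) {t : ℝ} (ht : -α k < t) :
    t ∈ interior (ProbabilityTheory.integrableExpSet (fun p => Real.log (p k)) (dirichlet α)) :=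
  interior_maximal (fun _ hs => integrable_exp_mul_log_dirichlet hα k hs) isOpen_Ioi ht

theorem hasDerivAt_Gamma_of_pos {x : ℝ} (hx : 0 < x) :
    HasDerivAt Real.Gamma (Real.Gamma x * digamma x) x := by
  have hd : DifferentiableAt ℝ Real.Gamma x := Real.differentiableAt_Gamma fun m => by
    have : (0 : ℝ) ≤ m := m.cast_nonneg
    linarith
  have hG := Real.Gamma_pos_of_pos hx
  have : digamma x = deriv Real.Gamma x / Real.Gamma x :=
    (hd.hasDerivAt.log hG.ne').deriv
  rw [this, mul_div_cancel₀ _ hG.ne']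
  exact hd.hasDerivAt

/-- Both sides are the derivative at `t` of the moment generating function, once under the integral
and once from the Gamma quotient. -/
theorem integral_log_mul_exp_dirichlet {K : ℕ} {α : Fin K → ℝ} (hα : ∀ k, 0 < α k)
    (k : Fin K) {t : ℝ} (ht : -α k < t) :
    ∫ p, Real.log (p k) * Real.exp (t * Real.log (p k)) ∂dirichlet α =
      Real.Gamma (strength α) * Real.Gamma (α k + t) /
        (Real.Gamma (α k) * Real.Gamma (strength α + t)) *
        (digamma (α k + t) - digamma (strength α + t)) := by
  have hk : α k ≤ strength α :=
    Finset.single_le_sum (fun i _ => (hα i).le) (Finset.mem_univ k)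
  have hkt : 0 < α k + t := by linarith
  have hSt : 0 < strength α + t := by linarith
  have h2 := Real.Gamma_pos_of_pos hSt
  have h3 := Real.Gamma_pos_of_pos (hα k)
  have hev : (fun s => Real.Gamma (strength α) * Real.Gamma (α k + s) /
        (Real.Gamma (α k) * Real.Gamma (strength α + s))) =ᶠ[𝓝 t]
      ProbabilityTheory.mgf (fun p => Real.log (p k)) (dirichlet α) :=
    (isOpen_Ioi.eventually_mem ht).mono fun s hs => (mgf_log_dirichlet hα k hs).symm
  have hd := (ProbabilityTheory.hasDerivAt_mgf
    (mem_interior_integrableExpSet_log_dirichlet hα k ht)).congr_of_eventuallyEq hev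
  have d1 := ((hasDerivAt_Gamma_of_pos hkt).comp_const_add (α k) t).const_mul
    (Real.Gamma (strength α))
  have d2 := ((hasDerivAt_Gamma_of_pos hSt).comp_const_add (strength α) t).const_mul
    (Real.Gamma (α k))
  rw [hd.unique (d1.div d2 (by positivity))]
  field_simp

theorem integrable_log_mul_exp_dirichlet {K : ℕ} {α : Fin K → ℝ} (hα : ∀ k, 0 < α k)
    (k : Fin K) {t : ℝ} (ht : -α k < t) :
    Integrable (fun p => Real.log (p k) * Real.exp (t * Real.log (p k))) (dirichlet α) := by
  simpa using ProbabilityTheory.integrable_pow_mul_exp_of_mem_interior_integrableExpSet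
    (mem_interior_integrableExpSet_log_dirichlet hα k ht) 1

theorem ae_exp_log_dirichlet {K : ℕ} (α : Fin K → ℝ) (k : Fin K) :
    (fun p => Real.exp (1 * Real.log (p k))) =ᵐ[dirichlet α] fun p => p k := by
  filter_upwards [ae_dirichlet α] with p hp
  rw [one_mul, Real.exp_log (hp.1 k)]

section
variable {K : ℕ} {α : Fin K → ℝ}

theorem integrable_coord_dirichlet (hα : ∀ k, 0 < α k) (k : Fin K) :
    Integrable (fun p => p k) (dirichlet α) :=
  (integrable_exp_mul_log_dirichlet hα k (by linarith [hα k])).congr (ae_exp_log_dirichlet α k)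

theorem integrable_log_dirichlet (hα : ∀ k, 0 < α k) (k : Fin K) :
    Integrable (fun p => Real.log (p k)) (dirichlet α) := by
  simpa using integrable_log_mul_exp_dirichlet hα k (t := 0) (by linarith [hα k])

theorem ae_mul_log_dirichlet (α : Fin K → ℝ) (k : Fin K) :
    (fun p => Real.log (p k) * Real.exp (1 * Real.log (p k))) =ᵐ[dirichlet α]
      fun p => p k * Real.log (p k) := by
  filter_upwards [ae_exp_log_dirichlet α k] with p hp
  rw [hp, mul_comm]

theorem integrable_mul_log_dirichlet (hα : ∀ k, 0 < α k) (k : Fin K) :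
    Integrable (fun p => p k * Real.log (p k)) (dirichlet α) :=
  (integrable_log_mul_exp_dirichlet hα k (by linarith [hα k])).congr (ae_mul_log_dirichlet α k)

theorem Gamma_ratio_add_one {a s : ℝ} (ha : 0 < a) (hs : 0 < s) :
    Real.Gamma s * Real.Gamma (a + 1) / (Real.Gamma a * Real.Gamma (s + 1)) = a / s := by
  have h1 := (Real.Gamma_pos_of_pos ha).ne'
  have h2 := (Real.Gamma_pos_of_pos hs).ne'
  rw [Real.Gamma_add_one ha.ne', Real.Gamma_add_one hs.ne']
  field_simp

theorem predictive_eq (hα : ∀ k, 0 < α k) (k : Fin K) :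
    predictive α k = α k / strength α := by
  rw [predictive, ← integral_congr_ae (ae_exp_log_dirichlet α k)]
  have := mgf_log_dirichlet hα k (t := 1) (by linarith [hα k])
  rw [ProbabilityTheory.mgf] at this
  rw [this, Gamma_ratio_add_one (hα k) (strength_pos k.pos hα)]

theorem integral_log_dirichlet (hα : ∀ k, 0 < α k) (k : Fin K) :
    ∫ p, Real.log (p k) ∂dirichlet α = digamma (α k) - digamma (strength α) := by
  have h1 := (Real.Gamma_pos_of_pos (hα k)).ne'
  have h2 := (Real.Gamma_pos_of_pos (strength_pos k.pos hα)).ne'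
  have := integral_log_mul_exp_dirichlet hα k (t := 0) (by linarith [hα k])
  simp only [zero_mul, Real.exp_zero, mul_one, add_zero] at this
  rw [this, mul_comm (Real.Gamma (α k)), div_self (mul_ne_zero h2 h1), one_mul]

theorem integral_mul_log_dirichlet (hα : ∀ k, 0 < α k) (k : Fin K) :
    ∫ p, p k * Real.log (p k) ∂dirichlet α =
      α k / strength α * (digamma (α k + 1) - digamma (strength α + 1)) := by
  rw [← integral_congr_ae (ae_mul_log_dirichlet α k),
    integral_log_mul_exp_dirichlet hα k (by linarith [hα k]),
    Gamma_ratio_add_one (hα k) (strength_pos k.pos hα)]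

/-- Differentiate `Γ(x + 1) = x Γ(x)` and divide by `Γ(x)`. -/
theorem digamma_add_one {x : ℝ} (hx : 0 < x) : digamma (x + 1) = digamma x + 1 / x := by
  have hG := Real.Gamma_pos_of_pos hx
  have h1 := (hasDerivAt_Gamma_of_pos (show 0 < x + 1 by linarith)).comp_add_const x 1
  have h2 := (hasDerivAt_id x).mul (hasDerivAt_Gamma_of_pos hx)
  have hev : (fun y => Real.Gamma (y + 1)) =ᶠ[𝓝 x] (id * Real.Gamma) :=
    (isOpen_Ioi.eventually_mem hx).mono fun y hy => Real.Gamma_add_one (ne_of_gt hy)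
  have := h1.unique (h2.congr_of_eventuallyEq hev)
  rw [Real.Gamma_add_one hx.ne'] at this
  simp only [id, one_mul] at this
  field_simp
  nlinarith [mul_left_cancel₀ hG.ne' (show Real.Gamma x * (x * digamma (x + 1)) =
    Real.Gamma x * (1 + x * digamma x) by linarith)]

end

/-! ### Vacuity and dissonance -/

theorem bal_le_one {x y : ℝ} (hx : 0 ≤ x) (hy : 0 ≤ y) : bal x y ≤ 1 := by
  rw [bal]
  split_ifs
  · linarith [div_nonneg (abs_nonneg (x - y)) (add_nonneg hx hy)]
  · exact zero_le_one

/-- Since the balance is at most 1, each summand is `b k` times a weighted average at most 1; a zero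
denominator gives 0. -/
theorem dissonance_le_sum {K : ℕ} {b : Fin K → ℝ} (hb : ∀ k, 0 ≤ b k) :
    dissonance b ≤ ∑ k, b k := by
  refine Finset.sum_le_sum fun k _ => div_le_of_le_mul₀ (Finset.sum_nonneg fun j _ => hb j) (hb k)
    (mul_le_mul_of_nonneg_left (Finset.sum_le_sum fun j _ => ?_) (hb k))
  exact mul_le_of_le_one_right (hb j) (bal_le_one (hb j) (hb k))

theorem vacuity_add_sum_belief {K : ℕ} {α : Fin K → ℝ} (hS : strength α ≠ 0) :
    vacuity α + ∑ k, belief α k = 1 := by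
  simp only [vacuity, belief]
  rw [← Finset.sum_div, ← add_div, Finset.sum_sub_distrib, div_eq_one_iff_eq hS]
  simp [strength]

/-! ### Entropies, mutual information and expected divergence -/

section
variable {K : ℕ} {α : Fin K → ℝ}

theorem sum_div_strength (hS : strength α ≠ 0) : ∑ k, α k / strength α = 1 := by
  rw [← Finset.sum_div]; exact div_self hS

theorem aleatoric_eq (hα : ∀ k, 0 < α k) (β : ℝ) :
    aleatoric β α = 1 / Real.log β *
      ∑ k, α k / strength α * (digamma (strength α + 1) - digamma (α k + 1)) := by
  have : ∀ p : Fin K → ℝ, shannonEntropy β p =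
      -(1 / Real.log β) * ∑ k, p k * Real.log (p k) := fun p => by
    simp only [shannonEntropy, Real.logb, Finset.mul_sum, ← Finset.sum_neg_distrib]
    exact Finset.sum_congr rfl fun k _ => by ring
  simp only [aleatoric, this]
  rw [integral_const_mul, integral_finsetSum _ fun k _ => integrable_mul_log_dirichlet hα k]
  simp only [integral_mul_log_dirichlet hα, Finset.mul_sum]
  exact Finset.sum_congr rfl fun k _ => by ring

theorem entropy_eq (hα : ∀ k, 0 < α k) (β : ℝ) :
    entropy β α = -∑ k, α k / strength α * Real.logb β (α k / strength α) := by
  simp only [entropy, shannonEntropy, predictive_eq hα]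

theorem epistemic_eq (hα : ∀ k, 0 < α k) (β : ℝ) :
    epistemic β α = -∑ k, α k / strength α * Real.logb β (α k / strength α) -
      1 / Real.log β *
        ∑ k, α k / strength α * (digamma (strength α + 1) - digamma (α k + 1)) := by
  rw [epistemic, aleatoric_eq hα, entropy_eq hα]

theorem epistemic_exp_one_eq (hα : ∀ k, 0 < α k) :
    epistemic (Real.exp 1) α = ∑ k, α k / strength α *
      (digamma (α k + 1) - digamma (strength α + 1) - Real.log (α k / strength α)) := by
  rw [epistemic_eq hα, Real.log_exp, div_one, one_mul, ← Finset.sum_neg_distrib,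
    ← Finset.sum_sub_distrib]
  refine Finset.sum_congr rfl fun k _ => ?_
  rw [Real.logb, Real.log_exp]
  ring

theorem epistemic_eq_div_log (hα : ∀ k, 0 < α k) (β : ℝ) :
    epistemic β α = epistemic (Real.exp 1) α / Real.log β := by
  rw [epistemic_exp_one_eq hα, epistemic_eq hα, Finset.sum_div, Finset.mul_sum,
    ← Finset.sum_neg_distrib, ← Finset.sum_sub_distrib]
  refine Finset.sum_congr rfl fun k _ => ?_
  rw [Real.logb]
  ring

theorem ae_klCat_eq (α : Fin K → ℝ) :
    (fun z : (Fin K → ℝ) × (Fin K → ℝ) => klCat z.1 z.2)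
      =ᵐ[(dirichlet α).prod (dirichlet α)]
    fun z => ∑ k, (z.1 k * Real.log (z.1 k) - z.1 k * Real.log (z.2 k)) := by
  -- With no positivity of `α` the measure need not be a probability; s-finiteness suffices for the
  -- product.
  have : SFinite (dirichlet α) := by unfold dirichlet simplexVolume; split <;> infer_instance
  filter_upwards [Measure.quasiMeasurePreserving_fst.ae (ae_dirichlet α),
    Measure.quasiMeasurePreserving_snd.ae (ae_dirichlet α)] with z h1 h2
  refine Finset.sum_congr rfl fun k _ => ?_
  rw [Real.log_div (h1.1 k).ne' (h2.1 k).ne', mul_sub]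

theorem integrable_klCat (hK : 0 < K) (hα : ∀ k, 0 < α k) :
    Integrable (fun z : (Fin K → ℝ) × (Fin K → ℝ) => klCat z.1 z.2)
      ((dirichlet α).prod (dirichlet α)) := by
  have := isProbabilityMeasure_dirichlet hK hα
  refine Integrable.congr ?_ (ae_klCat_eq α).symm
  exact integrable_finsetSum _ fun k _ => ((integrable_mul_log_dirichlet hα k).comp_fst _).sub
    ((integrable_coord_dirichlet hα k).mul_prod (integrable_log_dirichlet hα k))

theorem expectedPairwiseKL_eq_sum (hK : 0 < K) (hα : ∀ k, 0 < α k) :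
    expectedPairwiseKL α = ∑ k, α k / strength α *
      ((digamma (α k + 1) - digamma (strength α + 1)) -
        (digamma (α k) - digamma (strength α))) := by
  have := isProbabilityMeasure_dirichlet hK hα
  have h1 := fun k => (integrable_mul_log_dirichlet hα k).comp_fst (dirichlet α)
  have h2 := fun k => (integrable_coord_dirichlet hα k).mul_prod (integrable_log_dirichlet hα k)
  rw [expectedPairwiseKL, integral_congr_ae (ae_klCat_eq α),
    integral_finsetSum (f := fun k (z : (Fin K → ℝ) × (Fin K → ℝ)) =>
      z.1 k * Real.log (z.1 k) - z.1 k * Real.log (z.2 k)) _ fun k _ => (h1 k).sub (h2 k)]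
  refine Finset.sum_congr rfl fun k _ => ?_
  rw [integral_sub (h1 k) (h2 k),
    integral_fun_fst (μ := dirichlet α) (ν := dirichlet α) fun p => p k * Real.log (p k),
    integral_prod_mul (fun p : Fin K → ℝ => p k) fun q : Fin K → ℝ => Real.log (q k),
    integral_mul_log_dirichlet hα, integral_log_dirichlet hα, probReal_univ, one_smul,
    show ∫ p, p k ∂dirichlet α = α k / strength α from predictive_eq hα k]
  ring

/-- The digamma recurrence turns the `k`-th term into `(α_k / S)(1/α_k - 1/S)`. -/
theorem expectedPairwiseKL_eq (hK : 0 < K) (hα : ∀ k, 0 < α k) :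
    expectedPairwiseKL α = ((K : ℝ) - 1) / strength α := by
  have hS := strength_pos hK hα
  have : ∀ k, α k / strength α * ((digamma (α k + 1) - digamma (strength α + 1)) -
      (digamma (α k) - digamma (strength α))) =
      1 / strength α - α k / strength α / strength α := by
    intro k
    have := hα k
    rw [digamma_add_one (hα k), digamma_add_one hS]
    field_simp
    ring
  rw [expectedPairwiseKL_eq_sum hK hα, Finset.sum_congr rfl fun k _ => this k,
    Finset.sum_sub_distrib, ← Finset.sum_div Finset.univ fun k => α k / strength α,
    sum_div_strength hS.ne']
  simp
  ring

/-- Jensen for `log`, by integrating the tangent line at the mean `m`. -/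
theorem integral_log_dirichlet_le (hα : ∀ k, 0 < α k) (k : Fin K) :
    digamma (α k) - digamma (strength α) ≤ Real.log (α k / strength α) := by
  have := isProbabilityMeasure_dirichlet k.pos hα
  set m := α k / strength α
  have hm0 : 0 < m := div_pos (hα k) (strength_pos k.pos hα)
  have hi := integrable_coord_dirichlet hα k
  have hi' : Integrable (fun p => (p k - m) / m) (dirichlet α) :=
    (hi.sub (integrable_const m)).div_const m
  rw [← integral_log_dirichlet hα k]
  calc ∫ p, Real.log (p k) ∂dirichlet α ≤ ∫ p, (Real.log m + (p k - m) / m) ∂dirichlet α := by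
        refine integral_mono_ae (integrable_log_dirichlet hα k)
          ((integrable_const _).add hi') ?_
        filter_upwards [ae_dirichlet α] with p hp
        have h := Real.log_le_sub_one_of_pos (div_pos (hp.1 k) hm0)
        rw [Real.log_div (hp.1 k).ne' hm0.ne'] at h
        rw [sub_div, div_self hm0.ne']
        linarith
    _ = Real.log m := by
        rw [integral_add (integrable_const _) hi', integral_div,
          integral_sub hi (integrable_const m),
          show ∫ p, p k ∂dirichlet α = m from predictive_eq hα k]
        simp

theorem epistemic_le_expectedPairwiseKL (hK : 0 < K) (hα : ∀ k, 0 < α k) :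
    epistemic (Real.exp 1) α ≤ expectedPairwiseKL α := by
  rw [epistemic_exp_one_eq hα, expectedPairwiseKL_eq_sum hK hα]
  refine Finset.sum_le_sum fun k _ => mul_le_mul_of_nonneg_left ?_
    (div_pos (hα k) (strength_pos hK hα)).le
  linarith [integral_log_dirichlet_le hα k]

theorem epistemic_lt_vacuity (hK : 2 ≤ K) (hα : ∀ k, 0 < α k) :
    epistemic K α < vacuity α ∧ epistemic (Real.exp 1) α < vacuity α := by
  have hK0 : 0 < K := by omega
  have hS := strength_pos hK0 hα
  have h := epistemic_le_expectedPairwiseKL hK0 hα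
  rw [expectedPairwiseKL_eq hK0 hα] at h
  have hK2 : (2 : ℝ) ≤ K := by exact_mod_cast hK
  -- This is `log x < x - 1` at `x = 1/K`. It is needed because `ln 2 < 1`, so at `K = 2` the base
  -- `K` value exceeds the one in nats.
  have hlog : 1 - (K : ℝ)⁻¹ < Real.log K := by
    have h1 := Real.log_lt_sub_one_of_pos (x := (K : ℝ)⁻¹) (by positivity)
      (fun h => by rw [inv_eq_one] at h; linarith)
    rw [Real.log_inv] at h1
    linarith
  have hlog0 : 0 < Real.log K := Real.log_pos (by linarith)
  refine ⟨?_, h.trans_lt (div_lt_div_of_pos_right (by linarith) hS)⟩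
  rw [epistemic_eq_div_log hα, div_lt_iff₀ hlog0]
  refine h.trans_lt ?_
  rw [vacuity, div_mul_eq_mul_div]
  refine div_lt_div_of_pos_right ?_ hS
  have : (K : ℝ) * (1 - (K : ℝ)⁻¹) = K - 1 := by field_simp
  rw [← this]
  exact mul_lt_mul_of_pos_left hlog (by linarith)

/-- Strict Jensen for `x log x`; equality would make `p_k` almost surely constant. -/
theorem mul_log_lt_integral_dirichlet (hα : ∀ k, 0 < α k) (k : Fin K) (hk : α k < strength α) :
    α k / strength α * Real.log (α k / strength α) <
      α k / strength α * (digamma (α k + 1) - digamma (strength α + 1)) := by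
  have := isProbabilityMeasure_dirichlet k.pos hα
  have hS := strength_pos k.pos hα
  have hm : ∫ p, p k ∂dirichlet α = α k / strength α := predictive_eq hα k
  have hJ := Real.strictConvexOn_mul_log.ae_eq_const_or_map_average_lt
    (μ := dirichlet α) (f := fun p => p k) Real.continuous_mul_log.continuousOn isClosed_Ici
    ((ae_dirichlet α).mono fun p hp => (hp.1 k).le) (integrable_coord_dirichlet hα k)
    (integrable_mul_log_dirichlet hα k)
  simp only [average_eq_integral, hm, integral_mul_log_dirichlet hα] at hJ
  refine hJ.resolve_left fun hc => ?_
  -- For constant `p_k` the second moment `α_k(α_k + 1)/(S(S + 1))` would equal `(α_k / S)^2`,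
  -- forcing `α_k = S`.
  have h2 := mgf_log_dirichlet hα k (t := 1 + 1) (by linarith [hα k])
  rw [ProbabilityTheory.mgf, integral_congr_ae (g := fun _ => (α k / strength α) ^ 2) (by
      filter_upwards [hc, ae_dirichlet α] with p hp hp'
      rw [add_mul, Real.exp_add, one_mul, Real.exp_log (hp'.1 k), hp, sq]; rfl),
    integral_const, probReal_univ, one_smul, ← add_assoc, ← add_assoc,
    Real.Gamma_add_one (by linarith [hα k]), Real.Gamma_add_one (by linarith [hα k]),
    Real.Gamma_add_one (by linarith), Real.Gamma_add_one (by linarith)] at h2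
  have g1 := Real.Gamma_pos_of_pos (hα k)
  have g2 := Real.Gamma_pos_of_pos hS
  have := hα k
  field_simp at h2
  linarith

theorem lt_strength (hK : 2 ≤ K) (hα : ∀ k, 0 < α k) (k : Fin K) : α k < strength α := by
  have : Nontrivial (Fin K) := Fin.nontrivial_iff_two_le.2 hK
  obtain ⟨j, hj⟩ := exists_ne k
  exact Finset.single_lt_sum hj (Finset.mem_univ _) (Finset.mem_univ _) (hα j)
    fun i _ _ => (hα i).le

theorem epistemic_pos (hK : 2 ≤ K) (hα : ∀ k, 0 < α k) : 0 < epistemic K α := by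
  have hK2 : (2 : ℝ) ≤ K := by exact_mod_cast hK
  rw [epistemic_eq_div_log hα, epistemic_exp_one_eq hα]
  refine div_pos (Finset.sum_pos (fun k _ => ?_) ⟨⟨0, by omega⟩, Finset.mem_univ _⟩)
    (Real.log_pos (by linarith))
  rw [mul_sub]
  linarith [mul_log_lt_integral_dirichlet hα k (lt_strength hK hα k)]

end

/-! ### Equal parameters -/

section
variable {K : ℕ}

theorem strength_const (C : ℝ) : strength (fun _ : Fin K => C) = K * C := by
  simp [strength]

theorem vacuity_const (hK : 0 < K) (C : ℝ) : vacuity (fun _ : Fin K => C) = 1 / C := by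
  have : (K : ℝ) ≠ 0 := by positivity
  rw [vacuity, strength_const, ← div_div, div_self this]

theorem entropy_const (hK : 2 ≤ K) {C : ℝ} (hC : 0 < C) :
    entropy K (fun _ : Fin K => C) = 1 := by
  have hK2 : (2 : ℝ) ≤ K := by exact_mod_cast hK
  have hl : Real.log K ≠ 0 := (Real.log_pos (by linarith)).ne'
  have : C / (K * C) = (K : ℝ)⁻¹ := by field_simp
  rw [entropy_eq fun _ => hC, strength_const, this, Real.logb, Real.log_inv]
  simp
  field_simp

theorem aleatoric_const (hK : 0 < K) {C : ℝ} (hC : 0 < C) :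
    aleatoric K (fun _ : Fin K => C) =
      1 / Real.log K * (digamma (K * C + 1) - digamma (C + 1)) := by
  have : (K : ℝ) ≠ 0 := by positivity
  rw [aleatoric_eq fun _ => hC, strength_const, Finset.sum_const, Finset.card_univ,
    Fintype.card_fin, nsmul_eq_mul]
  field_simp

theorem digamma_natCast_add_one {C m : ℕ} (h : C ≤ m) :
    digamma (m + 1) - digamma (C + 1) = ∑ k ∈ Finset.Icc (C + 1) m, 1 / (k : ℝ) := by
  induction m, h using Nat.le_induction with
  | base => simp
  | succ m h ih =>
    rw [Finset.sum_Icc_succ_top (by omega), ← ih, digamma_add_one (by positivity)]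
    push_cast
    ring

theorem aleatoric_natCast (hK : 0 < K) {C : ℕ} (hC : 1 ≤ C) :
    aleatoric K (fun _ : Fin K => (C : ℝ)) =
      1 / Real.log K * ∑ k ∈ Finset.Icc (C + 1) (C * K), 1 / (k : ℝ) := by
  rw [aleatoric_const hK (by exact_mod_cast hC),
    ← digamma_natCast_add_one (Nat.le_mul_of_pos_right C hK)]
  push_cast
  rw [mul_comm (K : ℝ)]

theorem epistemic_const (hK : 2 ≤ K) {C : ℝ} (hC : 0 < C) :
    epistemic K (fun _ : Fin K => C) = 1 - aleatoric K (fun _ : Fin K => C) := by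
  rw [epistemic, entropy_const hK hC]

/-- All masses are equal and positive, so every balance is 1 and the dissonance is the total belief
mass. -/
theorem dissonance_belief_const (hK : 2 ≤ K) {C : ℝ} (hC : 1 < C) :
    dissonance (belief fun _ : Fin K => C) = 1 - 1 / C := by
  have hK2 : (2 : ℝ) ≤ K := by exact_mod_cast hK
  have hb : 0 < (C - 1) / (K * C) := div_pos (by linarith) (by positivity)
  have hbal : bal ((C - 1) / (K * C)) ((C - 1) / (K * C)) = 1 := by
    simp [bal, hb.ne']
  have hD : ∀ k : Fin K, ∑ j ∈ Finset.univ.erase k, (C - 1) / (K * C) ≠ 0 := fun k => by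
    rw [Finset.sum_const, Finset.card_erase_of_mem (Finset.mem_univ k), Finset.card_univ,
      Fintype.card_fin, nsmul_eq_mul]
    have : 0 < K - 1 := by omega
    positivity
  simp only [dissonance, belief, strength_const, hbal, mul_one]
  rw [Finset.sum_congr rfl fun k _ => mul_div_cancel_right₀ _ (hD k)]
  simp
  field_simp

theorem dissonance_belief_one : dissonance (belief fun _ : Fin K => (1 : ℝ)) = 0 := by
  simp [dissonance, belief]

/-- This says `u_alea > 1/2` at `C = 1`. The induction uses `log((n + 1)/n) ≤ 1/n ≤ 2/(n + 1)`,
starting from `log 2 < 1`. -/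
theorem log_lt_two_mul_sum (hK : 2 ≤ K) :
    Real.log K < 2 * ∑ k ∈ Finset.Icc 2 K, 1 / (k : ℝ) := by
  induction K, hK using Nat.le_induction with
  | base =>
    have := Real.log_lt_sub_one_of_pos (x := 2) two_pos (by norm_num)
    norm_num at this ⊢
    exact this
  | succ n hn ih =>
    have hn0 : (2 : ℝ) ≤ n := by exact_mod_cast hn
    rw [Finset.sum_Icc_succ_top (by omega)]
    have h1 := Real.log_le_sub_one_of_pos (x := ((n + 1 : ℕ) : ℝ) / n) (by positivity)
    rw [Real.log_div (by positivity) (by positivity)] at h1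
    have h2 : ((n + 1 : ℕ) : ℝ) / n - 1 ≤ 2 * (1 / ((n + 1 : ℕ) : ℝ)) := by
      push_cast
      rw [show ((n : ℝ) + 1) / n - 1 = 1 / n by field_simp; ring, mul_one_div,
        div_le_div_iff₀ (by positivity) (by positivity)]
      linarith
    linarith

end

theorem theorem1 (K : ℕ) (hK : 2 ≤ K) :
    -- 1 (a): every opinion, in particular the one given by Dirichlet parameters `α k = e k + 1`
    (∀ ω : Opinion K, ω.u + dissonance ω.b ≤ 1) ∧
    (∀ α : Fin K → ℝ, (∀ k, 1 ≤ α k) → vacuity α + dissonance (belief α) ≤ 1) ∧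
    -- 1 (b): in base `K` and in nats, with the bound by the expected pairwise divergence
    (∀ α : Fin K → ℝ, (∀ k, 0 < α k) →
      epistemic K α < vacuity α ∧
      epistemic (Real.exp 1) α < vacuity α ∧
      epistemic (Real.exp 1) α ≤ expectedPairwiseKL α ∧
      Integrable (fun z : (Fin K → ℝ) × (Fin K → ℝ) => klCat z.1 z.2)
        ((dirichlet α).prod (dirichlet α)) ∧
      expectedPairwiseKL α = ((K : ℝ) - 1) / strength α) ∧
    -- the digamma formulas
    (∀ α : Fin K → ℝ, (∀ k, 0 < α k) →
      aleatoric K α = 1 / Real.log K *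
        ∑ k, α k / strength α * (digamma (strength α + 1) - digamma (α k + 1)) ∧
      epistemic K α = -∑ k, α k / strength α * Real.logb K (α k / strength α) -
        1 / Real.log K *
          ∑ k, α k / strength α * (digamma (strength α + 1) - digamma (α k + 1))) ∧
    -- 2 (a): `α = (1, …, 1)`
    (1 = vacuity (fun _ : Fin K => (1 : ℝ)) ∧
      vacuity (fun _ : Fin K => (1 : ℝ)) = entropy K (fun _ : Fin K => (1 : ℝ)) ∧
      entropy K (fun _ : Fin K => (1 : ℝ)) > aleatoric K (fun _ : Fin K => (1 : ℝ)) ∧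
      aleatoric K (fun _ : Fin K => (1 : ℝ)) > epistemic K (fun _ : Fin K => (1 : ℝ)) ∧
      epistemic K (fun _ : Fin K => (1 : ℝ)) > dissonance (belief (fun _ : Fin K => (1 : ℝ))) ∧
      dissonance (belief (fun _ : Fin K => (1 : ℝ))) = 0 ∧
      aleatoric K (fun _ : Fin K => (1 : ℝ)) =
        1 / Real.log K * ∑ k ∈ Finset.Icc 2 K, 1 / (k : ℝ) ∧
      epistemic K (fun _ : Fin K => (1 : ℝ)) =
        1 - 1 / Real.log K * ∑ k ∈ Finset.Icc 2 K, 1 / (k : ℝ)) ∧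
    -- 2 (b): `α = (C, …, C)`, so that `S = K * C`
    ((∀ C : ℝ, 0 < C → entropy K (fun _ : Fin K => C) = 1) ∧
      Tendsto (fun C : ℝ => dissonance (belief (fun _ : Fin K => C))) atTop (𝓝 1) ∧
      Tendsto (fun C : ℝ => aleatoric K (fun _ : Fin K => C)) atTop (𝓝 1) ∧
      Tendsto (fun C : ℝ => vacuity (fun _ : Fin K => C)) atTop (𝓝 0) ∧
      Tendsto (fun C : ℝ => epistemic K (fun _ : Fin K => C)) atTop (𝓝 0) ∧
      (∀ C : ℝ, 2 < C →
        entropy K (fun _ : Fin K => C) > aleatoric K (fun _ : Fin K => C) ∧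
        aleatoric K (fun _ : Fin K => C) > dissonance (belief (fun _ : Fin K => C)) ∧
        dissonance (belief (fun _ : Fin K => C)) > vacuity (fun _ : Fin K => C) ∧
        vacuity (fun _ : Fin K => C) > epistemic K (fun _ : Fin K => C)) ∧
      (∀ C : ℕ, 1 ≤ C →
        aleatoric K (fun _ : Fin K => (C : ℝ)) =
          1 / Real.log K * ∑ k ∈ Finset.Icc (C + 1) (C * K), 1 / (k : ℝ) ∧
        epistemic K (fun _ : Fin K => (C : ℝ)) =
          1 - 1 / Real.log K * ∑ k ∈ Finset.Icc (C + 1) (C * K), 1 / (k : ℝ))) := by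
  have hK0 : 0 < K := by omega
  have hK2 : (2 : ℝ) ≤ K := by exact_mod_cast hK
  have hlog : 0 < Real.log K := Real.log_pos (by linarith)
  have hC1 := aleatoric_natCast hK0 le_rfl
  rw [Nat.cast_one, one_mul] at hC1
  have hE1 := epistemic_const hK (one_pos : (0 : ℝ) < 1)
  have hvac : Tendsto (fun C : ℝ => vacuity (fun _ : Fin K => C)) atTop (𝓝 0) := by
    simp only [vacuity_const hK0, one_div]
    exact tendsto_inv_atTop_zero
  have hepis : Tendsto (fun C : ℝ => epistemic K (fun _ : Fin K => C)) atTop (𝓝 0) := by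
    refine tendsto_of_tendsto_of_tendsto_of_le_of_le' tendsto_const_nhds hvac ?_ ?_
    · filter_upwards [eventually_gt_atTop 0] with C hC using (epistemic_pos hK fun _ => hC).le
    · filter_upwards [eventually_gt_atTop 0] with C hC
        using (epistemic_lt_vacuity hK fun _ => hC).1.le
  refine ⟨fun ω => ?_, fun α hα => ?_, fun α hα => ?_, fun α hα => ?_, ?_, ?_⟩
  · linarith [dissonance_le_sum ω.b_nonneg, ω.sum_b_add_u]
  · have hS := strength_pos hK0 fun k => zero_lt_one.trans_le (hα k)
    rw [← vacuity_add_sum_belief hS.ne']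
    exact add_le_add_right (dissonance_le_sum fun k =>
      div_nonneg (sub_nonneg.2 (hα k)) hS.le) _
  · exact ⟨(epistemic_lt_vacuity hK hα).1, (epistemic_lt_vacuity hK hα).2,
      epistemic_le_expectedPairwiseKL hK0 hα, integrable_klCat hK0 hα,
      expectedPairwiseKL_eq hK0 hα⟩
  · exact ⟨aleatoric_eq hα K, epistemic_eq hα K⟩
  · have hpos := epistemic_pos hK fun _ : Fin K => (one_pos : (0 : ℝ) < 1)
    have hhalf : 1 / 2 < aleatoric K (fun _ : Fin K => (1 : ℝ)) := by
      rw [hC1, one_div_mul_eq_div, lt_div_iff₀ hlog]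
      linarith [log_lt_two_mul_sum hK]
    rw [vacuity_const hK0, entropy_const hK one_pos, dissonance_belief_one]
    exact ⟨by norm_num, by norm_num, by linarith, by linarith, hpos, rfl, hC1, hC1 ▸ hE1⟩
  · refine ⟨fun C hC => entropy_const hK hC, ?_, ?_, hvac, hepis, fun C hC => ?_, fun C hC => ?_⟩
    · have h : Tendsto (fun C : ℝ => 1 - 1 / C) atTop (𝓝 1) := by
        simpa using tendsto_inv_atTop_zero.const_sub (1 : ℝ)
      refine h.congr' ?_
      filter_upwards [eventually_gt_atTop 1] with C hC
        using (dissonance_belief_const hK hC).symm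
    · have h : Tendsto (fun C : ℝ => 1 - epistemic K (fun _ : Fin K => C)) atTop (𝓝 1) := by
        simpa using hepis.const_sub (1 : ℝ)
      refine h.congr' ?_
      filter_upwards [eventually_gt_atTop 0] with C hC
      rw [epistemic_const hK hC, sub_sub_cancel]
    · have hC0 : 0 < C := by linarith
      have h1 := epistemic_pos hK fun _ : Fin K => hC0
      have h2 := (epistemic_lt_vacuity hK fun _ : Fin K => hC0).1
      -- `C > 2` is what puts `1 - 1/C` above `1/C`; `u_alea > 1 - 1/C` restates `u_epis < 1/C`.
      have h3 : 1 / C < 1 / 2 := one_div_lt_one_div_of_lt two_pos hC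
      rw [epistemic_const hK hC0] at h1 h2 ⊢
      rw [vacuity_const hK0] at h2 ⊢
      rw [entropy_const hK hC0, dissonance_belief_const hK (by linarith)]
      exact ⟨by linarith, by linarith, by linarith, h2⟩
    · have hC0 : (0 : ℝ) < C := by exact_mod_cast hC
      exact ⟨aleatoric_natCast hK0 hC, by
        rw [epistemic_const hK hC0, aleatoric_natCast hK0 hC]⟩
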